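/- Let $T\ge 1$ be an integer, and let $\mathcal U_T$ be the set of real trinomials $P(z)=z+xz^{1+T}+yz^{1+2T}$ ($x,y\in\mathbb R$) that are univalent (injective) in the open unit disk $\mathbb D$. Let $$S^{(T)}(z)=z+\sum_{j=2}^{3}\left(1-\frac{(j-1)T}{1+2T}\right)\prod_{k=1}^{j-1}\frac{\sin\frac{\pi(2+T(k-1))}{2+2T}}{\sin\frac{\pi Tk}{2+2T}}\,z^{T(j-1)+1},$$ and let $Q^{(T)}(z)=e^{-i\pi/T}S^{(T)}(e^{i\pi/T}z)$, a polynomial with real coefficients. Then $$S^{(T)}(z)=z+\frac{2(1+T)}{1+2T}\sin\frac{\pi}{2+2T}\,z^{1+T}+\frac{1}{1+2T}z^{1+2T},$$ $Q^{(T)}(z)=-S^{(T)}(-z)$ if $T$ is odd, both $S^{(T)}$ and $Q^{(T)}$ belong to $\mathcal U_T$ and have leading coefficient $\frac1{1+2T}$, and the following hold. (c) If $P\in\mathcal U_T$ has coefficient $\frac1{1+2T}$ at $z^{1+2T}$, then the absolute value of each coefficient of $P$ is at most the corresponding coefficient of $S^{(T)}$. The absolute value of the coefficient of $P$ at $z^{1+T}$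 equals the coefficient of $S^{(T)}$ at $z^{1+T}$ if and only if $P=S^{(T)}$ or $P=Q^{(T)}$. (d) $\displaystyle\max_{P\in\mathcal U_T}\max_{|z|\le1}|P(z)|=S^{(T)}(1)$, and for $P\in\mathcal U_T$ one has $\max_{|z|\le1}|P(z)|=S^{(T)}(1)$ if and only if $P=S^{(T)}$ or $P=Q^{(T)}$. (e) $P(1)>0$ for every $P\in\mathcal U_T$, and $$\min_{P\in\mathcal U_T}\frac{|P(e^{i\pi/T})|}{P(1)}=\frac{|S^{(T)}(e^{i\pi/T})|}{S^{(T)}(1)}=\left(\frac{1-\sin\frac{\pi}{2+2T}}{\cos\frac{\pi}{2+2T}}\right)^2,$$ and $S^{(T)}$ is the only polynomial in $\mathcal U_T$ that attains the minimum. -/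

import Mathlib

open Polynomial

noncomputable section

/-- The real trinomial `z + x z^(1+T) + y z^(1+2T)`. -/
def trinomialT (T : ℕ) (x y : ℝ) : ℝ[X] :=
  X + C x * X ^ (1 + T) + C y * X ^ (1 + 2 * T)

/-- The `T`-symmetric real trinomials `z + x z^(1+T) + y z^(1+2T)` that are univalent
(injective) in the open unit disk. -/
def univalentTrinomials (T : ℕ) : Set ℝ[X] :=
  {P | (∃ x y : ℝ, P = trinomialT T x y) ∧
    Set.InjOn (fun z : ℂ => aeval z P) (Metric.ball 0 1)}

/-- The `T`-symmetric analogue `S^(T)` of the Suffridge polynomial, of degree `1 + (n-1) T`. -/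
def suffridgeT (T n : ℕ) : ℝ[X] :=
  X + ∑ j ∈ Finset.Icc 2 n,
    C ((1 - ((j : ℝ) - 1) * T / (1 + ((n : ℝ) - 1) * T)) *
        ∏ k ∈ Finset.Icc 1 (j - 1),
          (Real.sin (Real.pi * (2 + (T : ℝ) * ((k : ℝ) - 1)) / (2 + (T : ℝ) * ((n : ℝ) - 1))) /
            Real.sin (Real.pi * (T : ℝ) * (k : ℝ) / (2 + (T : ℝ) * ((n : ℝ) - 1))))) *
      X ^ (T * (j - 1) + 1)

/-- `max_{|z| ≤ 1} |P(z)|`; the supremum is attained since the closed disk is compact. -/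
def maxModulus (P : ℝ[X]) : ℝ :=
  sSup ((fun z : ℂ => ‖aeval z P‖) '' Metric.closedBall 0 1)

/-- The quotient `|P(e^{iπ/T})| / P(1)`. -/
def angularRatio (T : ℕ) (P : ℝ[X]) : ℝ :=
  ‖aeval (Complex.exp (Complex.I * Real.pi / T)) P‖ / P.eval 1

end

/-! By Dieudonné's criterion, univalence of `z + x z^(1+T) + y z^(1+2T)` means that for each `t` in
`(0, π)` the quadratic `sin t + x sin((1+T)t) w + y sin((1+2T)t) w²` has no zero in the open disk.
For a real quadratic this is a pair of linear inequalities in `|x|` and `y` (`dieudonne_necessary`,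
`dieudonne_sufficient`).

Put `α = π/(2+2T)`, so `(1+T)α = π/2` and `(1+2T)α = π - α`. Taking `t = α` gives `|x| ≤ sin α · (1
+ y)` (`abs_middle_le`), and `t → 0` gives `|y| ≤ 1/(1+2T)` (`abs_top_le`). The extremal claims are
elementary consequences of these two bounds, with equality in both exactly at `S` and `Q` when `y >
0`. Uniqueness for the quotient needs more, since equality in the first bound alone leaves `y` free:
there `α` is an interior minimum, and the vanishing derivative fixes `y` (`top_eq_of_middle_eq`).

That `S` and `Q` are univalent amounts to the trigonometric inequality `sin_inequality`. -/

/-! ### Univalence in the disk from injectivity on circles. -/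

open Filter Topology in
/-- A holomorphic map of the unit disk that is injective on every circle centred at the origin and
has no critical points is injective. -/
theorem injOn_ball_of_injOn_circles {f f' : ℂ → ℂ} (hf : ∀ z, HasStrictDerivAt f (f' z) z)
    (hf' : ∀ z, ‖z‖ < 1 → f' z ≠ 0)
    (hc : ∀ z w, ‖z‖ < 1 → ‖z‖ = ‖w‖ → f z = f w → z = w) :
    Set.InjOn f (Metric.ball 0 1) := by
  have hcont : Continuous f := continuous_iff_continuousAt.2 fun z => (hf z).hasDerivAt.continuousAt
  by_contra hinj
  obtain ⟨a, ha, b, hb, hab, hne⟩ : ∃ a ∈ Metric.ball (0 : ℂ) 1, ∃ b ∈ Metric.ball (0 : ℂ) 1,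
      f a = f b ∧ a ≠ b := by
    simpa only [Set.InjOn, not_forall, exists_prop] using hinj
  rw [mem_ball_zero_iff] at ha hb
  obtain ⟨ρ, hρ, hρ1⟩ : ∃ ρ, max ‖a‖ ‖b‖ ≤ ρ ∧ ρ < 1 := ⟨_, le_rfl, max_lt ha hb⟩
  set C : Set (ℂ × ℂ) :=
    (Metric.closedBall 0 ρ ×ˢ Metric.closedBall 0 ρ) ∩ {p | f p.1 = f p.2} with hC
  have hCc : IsCompact C :=
    ((isCompact_closedBall _ _).prod (isCompact_closedBall _ _)).inter_right
      (isClosed_eq (hcont.comp continuous_fst) (hcont.comp continuous_snd))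
  -- Removing the diagonal keeps the set closed, since `f` is locally injective at each point. Hence
  -- some pair in `K` minimizes the larger of the two norms.
  set K : Set (ℂ × ℂ) := C ∩ {p | p.1 ≠ p.2} with hK
  have hKclosed : IsClosed K := by
    refine isClosed_of_closure_subset fun p hp => ?_
    have hpC : p ∈ C := closure_minimal Set.inter_subset_left hCc.isClosed hp
    refine ⟨hpC, fun hpe => ?_⟩
    have hp1 : ‖p.1‖ < 1 := lt_of_le_of_lt (by simpa using hpC.1.1) hρ1
    have hev := (hf p.1).eventually_left_inverse (hf' p.1 hp1)
    have hev2 : ∀ᶠ q : ℂ × ℂ in 𝓝 p, f q.1 = f q.2 → q.1 = q.2 := by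
      have h1 := continuous_fst.continuousAt (x := p) |>.eventually hev
      have h2 := continuous_snd.continuousAt (x := p) |>.eventually
        (p := fun w => (hf p.1).localInverse f (f' p.1) p.1 (hf' p.1 hp1) (f w) = w)
        (by simpa only [← show p.1 = p.2 from hpe] using hev)
      filter_upwards [h1, h2] with q hq1 hq2 hq
      rw [← hq1, hq, hq2]
    obtain ⟨q, hqK, hq⟩ := (mem_closure_iff_frequently.1 hp).and_eventually hev2 |>.exists
    exact hqK.2 (hq hqK.1.2)
  have hKc : IsCompact K := hCc.of_isClosed_subset hKclosed Set.inter_subset_left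
  have hKne : K.Nonempty := ⟨(a, b), ⟨⟨by simpa using (le_max_left _ _).trans hρ,
    by simpa using (le_max_right _ _).trans hρ⟩, hab⟩, hne⟩
  obtain ⟨p, hpK, hmin⟩ := hKc.exists_isMinOn hKne
    ((continuous_fst.norm.max continuous_snd.norm).continuousOn)
  -- If the norms differ, `v` can be moved inwards: `f` is open at `u`, so the new value is still
  -- taken near `u`. This contradicts minimality.
  have key : ∀ u v : ℂ, ‖u‖ < ‖v‖ → ‖v‖ ≤ ρ → f u = f v →
      ∃ z w, ‖z‖ < ‖v‖ ∧ ‖w‖ < ‖v‖ ∧ f z = f w ∧ z ≠ w := by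
    intro u v huv hv huv'
    obtain ⟨U, V, hU, hV, huU, hvV, hUV⟩ := t2_separation (show u ≠ v by rintro rfl; exact huv.ne rfl)
    have hmap := (hf u).map_nhds_eq (hf' u (by linarith))
    have hUn : U ∩ Metric.ball 0 ‖v‖ ∈ 𝓝 u :=
      inter_mem (hU.mem_nhds huU) (Metric.isOpen_ball.mem_nhds (by simpa using huv))
    have himg : f '' (U ∩ Metric.ball 0 ‖v‖) ∈ 𝓝 (f v) := by
      rw [← huv', ← hmap]; exact image_mem_map hUn
    have hev : ∀ᶠ w in 𝓝 v, f w ∈ f '' (U ∩ Metric.ball 0 ‖v‖) ∧ w ∈ V :=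
      (hcont.continuousAt.eventually himg).and (hV.mem_nhds hvV)
    have hv0 : ‖v‖ ≠ 0 := ((norm_nonneg u).trans_lt huv).ne'
    have hcl : v ∈ closure (Metric.ball (0 : ℂ) ‖v‖) := by
      rw [closure_ball _ hv0]; simp
    obtain ⟨w, hw, ⟨z, hz, hzw⟩, hwV⟩ :=
      (mem_closure_iff_frequently.1 hcl).and_eventually hev |>.exists
    exact ⟨z, w, by simpa using hz.2, by simpa using hw, hzw,
      fun h => Set.disjoint_left.1 hUV hz.1 (h ▸ hwV)⟩
  have hcontra : ∀ z w : ℂ, ‖z‖ < max ‖p.1‖ ‖p.2‖ → ‖w‖ < max ‖p.1‖ ‖p.2‖ →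
      f z = f w → z ≠ w → False := by
    intro z w hz hw h hzw
    have hp1 : ‖p.1‖ ≤ ρ := by simpa using hpK.1.1.1
    have hp2 : ‖p.2‖ ≤ ρ := by simpa using hpK.1.1.2
    have hm := max_le hp1 hp2
    have : max ‖p.1‖ ‖p.2‖ ≤ max ‖z‖ ‖w‖ :=
      hmin (a := (z, w)) ⟨⟨⟨by simpa using hz.le.trans hm, by simpa using hw.le.trans hm⟩, h⟩, hzw⟩
    exact absurd (max_lt hz hw) this.not_gt
  have hp1 : ‖p.1‖ ≤ ρ := by simpa using hpK.1.1.1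
  have hp2 : ‖p.2‖ ≤ ρ := by simpa using hpK.1.1.2
  rcases lt_trichotomy ‖p.1‖ ‖p.2‖ with h | h | h
  · obtain ⟨z, w, hz, hw, hzw, hne⟩ := key _ _ h hp2 hpK.1.2
    rw [max_eq_right h.le] at hcontra
    exact hcontra z w hz hw hzw hne
  · exact hpK.2 (hc _ _ (hp1.trans_lt hρ1) h hpK.1.2)
  · obtain ⟨z, w, hz, hw, hzw, hne⟩ := key _ _ h hp1 hpK.1.2.symm
    rw [max_eq_left h.le] at hcontra
    exact hcontra z w hz hw hzw hne

/-! ### Zeros of real quadratics in the unit disk. -/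

/-- A real quadratic `1 + b w + c w²` with `|c| ≤ 1` and `|b| ≤ 1 + c` has no zero in the disk. -/
theorem quadratic_ne_zero {b c : ℝ} (hc : |c| ≤ 1) (hb : |b| ≤ 1 + c) {w : ℂ} (hw : ‖w‖ < 1) :
    (1 : ℂ) + b * w + c * w ^ 2 ≠ 0 := by
  intro h
  obtain ⟨p, q⟩ := w
  have hre := congrArg Complex.re h
  have him := congrArg Complex.im h
  simp [pow_two] at hre him
  have hn : p * p + q * q < 1 := by
    have := Complex.sq_norm ⟨p, q⟩
    rw [Complex.normSq_mk] at this
    rw [← this]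
    exact pow_lt_one₀ (norm_nonneg _) hw two_ne_zero
  rw [abs_le] at hc hb
  rcases eq_or_ne q 0 with rfl | hq
  · have hp1 : |p| < 1 := by rw [abs_lt]; constructor <;> nlinarith
    rw [abs_lt] at hp1
    rcases le_total 0 p with hp | hp
    -- The value is at least `1 - (1 + c)p + cp² = (1 - p)(1 - cp)`.
    · nlinarith [mul_nonneg hp (sub_nonneg.2 hb.1), mul_pos (sub_pos.2 hp1.2)
        (show 0 < 1 - c * p by nlinarith)]
    · nlinarith [mul_nonneg (neg_nonneg.2 hp) (sub_nonneg.2 hb.2),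
        mul_pos (show 0 < 1 + p by linarith) (show 0 < 1 + c * p by nlinarith)]
  -- A non-real root comes with its conjugate, so `c |w|² = 1`, impossible for `|w| < 1`.
  · have h2 : b + 2 * c * p = 0 := by
      have : q * (b + 2 * c * p) = 0 := by linarith
      exact (mul_eq_zero.1 this).resolve_left hq
    have h3 : c * (p * p + q * q) = 1 := by
      have : b = -2 * c * p := by linarith
      rw [this] at hre; linarith
    nlinarith [mul_self_nonneg p, mul_self_nonneg q]

/-- If `|c| > 1` or `|b| > 1 + c` then `1 + b w + c w²` has a zero in the open unit disk. -/
theorem exists_quadratic_root_norm_lt_one {b c : ℝ} (h : 1 < |c| ∨ 1 + c < |b|) :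
    ∃ w : ℂ, ‖w‖ < 1 ∧ (1 : ℂ) + b * w + c * w ^ 2 = 0 := by
  -- If `|c| > 1`, the roots of the reciprocal polynomial `v² + b v + c` have product `c`, so one
  -- lies outside the closed disk and its inverse is the required root. If `|b| > 1 + c`, the
  -- quadratic is `1` at `0` and negative at `1` or `-1`.
  rcases h with hc | hb
  · obtain ⟨d, hd⟩ := IsAlgClosed.exists_pow_nat_eq ((b : ℂ) ^ 2 - 4 * c) two_pos
    have root : ∀ v : ℂ, v ^ 2 + b * v + c = 0 → 1 < ‖v‖ →
        ∃ w : ℂ, ‖w‖ < 1 ∧ (1 : ℂ) + b * w + c * w ^ 2 = 0 := by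
      intro v hv hv1
      have hv0 : v ≠ 0 := norm_pos_iff.1 (by linarith)
      refine ⟨v⁻¹, by rw [norm_inv]; exact inv_lt_one_of_one_lt₀ hv1, ?_⟩
      field_simp
      linear_combination hv
    by_cases h1 : 1 < ‖(-b + d) / 2‖
    · exact root _ (by linear_combination hd / 4) h1
    · refine root ((-b - d) / 2) (by linear_combination hd / 4) ?_
      have hprod : ‖(-b + d) / 2‖ * ‖(-b - d) / 2‖ = |c| := by
        rw [← norm_mul]
        rw [show (-b + d) / 2 * ((-b - d) / 2) = (c : ℂ) by linear_combination -hd / 4]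
        simp
      by_contra h2
      push Not at h1 h2
      nlinarith [norm_nonneg ((-b + d) / 2), norm_nonneg ((-b - d) / 2)]
  · have real_root : ∃ r : ℝ, |r| < 1 ∧ 1 + b * r + c * r ^ 2 = 0 := by
      have hcont : Continuous fun r : ℝ => 1 + b * r + c * r ^ 2 := by fun_prop
      rcases lt_abs.1 hb with h | h
      · obtain ⟨r, hr, hr0⟩ := intermediate_value_Ioo (by norm_num : (-1 : ℝ) ≤ 0)
          hcont.continuousOn (show (0 : ℝ) ∈ _ by constructor <;> norm_num; linarith)
        exact ⟨r, by rw [abs_lt]; constructor <;> linarith [hr.1, hr.2], hr0⟩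
      · obtain ⟨r, hr, hr0⟩ := intermediate_value_Ioo' (by norm_num : (0 : ℝ) ≤ 1)
          hcont.continuousOn (show (0 : ℝ) ∈ _ by constructor <;> norm_num; linarith)
        exact ⟨r, by rw [abs_lt]; constructor <;> linarith [hr.1, hr.2], hr0⟩
    obtain ⟨r, hr, hr0⟩ := real_root
    exact ⟨r, by simpa using hr, by exact_mod_cast hr0⟩

/-! ### Dieudonné's criterion for trinomials. -/

theorem aeval_trinomialT (T : ℕ) (x y : ℝ) (z : ℂ) :
    aeval z (trinomialT T x y) = z + x * z ^ (1 + T) + y * z ^ (1 + 2 * T) := by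
  simp [trinomialT]

theorem Complex.exp_pow_sub_exp_neg_pow (n : ℕ) (t : ℝ) :
    Complex.exp (t * Complex.I) ^ n - Complex.exp (-(t * Complex.I)) ^ n =
      2 * Complex.I * Real.sin (n * t) := by
  rw [← Complex.exp_nat_mul, ← Complex.exp_nat_mul, Complex.ofReal_sin, Complex.sin]
  push_cast
  rw [show (n : ℂ) * (t * I) = n * t * I by ring, show (n : ℂ) * -(t * I) = -(n * t) * I by ring]
  linear_combination (Complex.exp (n * t * I) - Complex.exp (-(n * t) * I)) * Complex.I_sq

/-- Two points of a circle are written through the midpoint `z` of their arc; a collision of values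
then becomes a root `z^T` of a real quadratic. -/
theorem trinomialT_sub (T : ℕ) (x y t : ℝ) (z : ℂ) :
    aeval (z * Complex.exp (t * Complex.I)) (trinomialT T x y) -
      aeval (z * Complex.exp (-(t * Complex.I))) (trinomialT T x y) =
    2 * Complex.I * z * (Real.sin t + x * Real.sin ((1 + T) * t) * z ^ T +
      y * Real.sin ((1 + 2 * T) * t) * (z ^ T) ^ 2) := by
  have h0 := Complex.exp_pow_sub_exp_neg_pow 1 t
  have h1 := Complex.exp_pow_sub_exp_neg_pow (1 + T) t
  have h2 := Complex.exp_pow_sub_exp_neg_pow (1 + 2 * T) t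
  push_cast at h0 h1 h2
  rw [pow_one, pow_one, one_mul] at h0
  simp only [aeval_trinomialT, mul_pow]
  push_cast
  linear_combination z * h0 + x * z ^ (1 + T) * h1 + y * z ^ (1 + 2 * T) * h2

/-- Dieudonné's criterion, necessity. -/
theorem dieudonne_necessary {T : ℕ} (hT : 1 ≤ T) {x y : ℝ}
    (h : trinomialT T x y ∈ univalentTrinomials T) {t : ℝ} (ht0 : 0 < t) (htπ : t < Real.pi) :
    |y * Real.sin ((1 + 2 * T) * t)| ≤ Real.sin t ∧
      |x * Real.sin ((1 + T) * t)| ≤ Real.sin t + y * Real.sin ((1 + 2 * T) * t) := by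
  have hs : 0 < Real.sin t := Real.sin_pos_of_pos_of_lt_pi ht0 htπ
  by_contra hcon
  set B := x * Real.sin ((1 + T) * t) with hB
  set C := y * Real.sin ((1 + 2 * T) * t) with hC
  obtain ⟨w, hw, hw0⟩ : ∃ w : ℂ, ‖w‖ < 1 ∧
      (1 : ℂ) + ((B / Real.sin t : ℝ) : ℂ) * w + ((C / Real.sin t : ℝ) : ℂ) * w ^ 2 = 0 := by
    apply exists_quadratic_root_norm_lt_one
    rw [abs_div, abs_div, abs_of_pos hs, lt_div_iff₀ hs, lt_div_iff₀ hs, add_mul,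
      div_mul_cancel₀ _ hs.ne', one_mul]
    by_contra! h'
    exact hcon h'
  obtain ⟨z, hz⟩ := IsAlgClosed.exists_pow_nat_eq w hT
  have hsC : (Real.sin t : ℂ) ≠ 0 := by exact_mod_cast hs.ne'
  have hz1 : ‖z‖ < 1 := by
    rw [← hz, norm_pow] at hw
    exact (pow_lt_one_iff_of_nonneg (norm_nonneg _) (by omega)).1 hw
  have hz0 : z ≠ 0 := by
    rintro rfl
    rw [zero_pow (by omega)] at hz
    rw [← hz] at hw0
    simp at hw0
  have hsub := trinomialT_sub T x y t z
  have hquad : (Real.sin t : ℂ) + x * Real.sin ((1 + T) * t) * z ^ T +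
      y * Real.sin ((1 + 2 * T) * t) * (z ^ T) ^ 2 = 0 := by
    rw [hz]
    have : (Real.sin t : ℂ) * ((1 : ℂ) + ((B / Real.sin t : ℝ) : ℂ) * w +
      ((C / Real.sin t : ℝ) : ℂ) * w ^ 2) = 0 := by rw [hw0, mul_zero]
    rw [← this, hB, hC]
    push_cast at hsC ⊢
    field_simp
  rw [hquad, mul_zero, sub_eq_zero] at hsub
  have hnorm : ∀ r : ℝ, ‖z * Complex.exp (r * Complex.I)‖ < 1 := fun r => by
    rw [norm_mul, Complex.norm_exp_ofReal_mul_I, mul_one]; exact hz1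
  -- Injectivity makes the two points coincide, which would force `sin t = 0`.
  have heq := h.2 (mem_ball_zero_iff.2 (hnorm t))
    (mem_ball_zero_iff.2 (by simpa using hnorm (-t))) hsub
  have h1 := Complex.exp_pow_sub_exp_neg_pow 1 t
  rw [pow_one, pow_one, mul_left_cancel₀ hz0 heq, sub_self, Nat.cast_one, one_mul] at h1
  simp [Complex.I_ne_zero] at h1
  exact hsC (by rw [Complex.ofReal_sin]; exact h1)

/-- A function vanishing at `0` and nonnegative on `(0, b)` has nonnegative derivative at `0`. -/
theorem HasDerivAt.nonneg_of_nonneg_Ioo {f : ℝ → ℝ} {f' : ℝ} (hf : HasDerivAt f f' 0)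
    (h0 : f 0 = 0) {b : ℝ} (hb : 0 < b) (h : ∀ t, 0 < t → t < b → 0 ≤ f t) : 0 ≤ f' := by
  refine ge_of_tendsto hf.tendsto_slope_zero_right ?_
  filter_upwards [Ioo_mem_nhdsGT hb] with t ht
  rw [zero_add, h0, sub_zero, smul_eq_mul]
  exact mul_nonneg (inv_nonneg.2 ht.1.le) (h t ht.1 ht.2)

theorem hasDerivAt_sin_const_mul (a t : ℝ) :
    HasDerivAt (fun t => Real.sin (a * t)) (a * Real.cos (a * t)) t := by
  have := ((hasDerivAt_id t).const_mul a).sin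
  simpa [mul_comm] using this

theorem hasDerivAt_sin_comb (a b c m n t : ℝ) :
    HasDerivAt (fun t => a * Real.sin t + b * Real.sin (m * t) + c * Real.sin (n * t))
      (a * Real.cos t + b * (m * Real.cos (m * t)) + c * (n * Real.cos (n * t))) t :=
  (((Real.hasDerivAt_sin t).const_mul a).add ((hasDerivAt_sin_const_mul m t).const_mul b)).add
    ((hasDerivAt_sin_const_mul n t).const_mul c)

/-- The limit `t → 0⁺` of an inequality between sines. It yields the bound on `y` and the absence of
critical points. -/
theorem sin_comb_deriv_nonneg {a b c m n : ℝ}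
    (h : ∀ t, 0 < t → t < Real.pi → 0 ≤ a * Real.sin t + b * Real.sin (m * t) +
      c * Real.sin (n * t)) : 0 ≤ a + b * m + c * n := by
  have := (hasDerivAt_sin_comb a b c m n 0).nonneg_of_nonneg_Ioo (by simp) Real.pi_pos h
  simpa using this

/-- Dieudonné's criterion, sufficiency. -/
theorem dieudonne_sufficient {T : ℕ} (hT : 1 ≤ T) {x y : ℝ}
    (h1 : ∀ t, 0 < t → t < Real.pi → |y * Real.sin ((1 + 2 * T) * t)| ≤ Real.sin t)
    (h2 : ∀ t, 0 < t → t < Real.pi →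
      |x * Real.sin ((1 + T) * t)| ≤ Real.sin t + y * Real.sin ((1 + 2 * T) * t)) :
    trinomialT T x y ∈ univalentTrinomials T := by
  refine ⟨⟨x, y, rfl⟩, ?_⟩
  refine injOn_ball_of_injOn_circles (fun z => (trinomialT T x y).hasStrictDerivAt_aeval z) ?_ ?_
  · intro z hz
    have hderiv : aeval z (derivative (trinomialT T x y)) =
        1 + ((x * (1 + T) : ℝ) : ℂ) * z ^ T + ((y * (1 + 2 * T) : ℝ) : ℂ) * (z ^ T) ^ 2 := by
      simp only [trinomialT, derivative_X, derivative_C_mul_X_pow, map_add, map_one,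
        map_mul, map_pow, aeval_X, aeval_C, add_tsub_cancel_left, Complex.coe_algebraMap]
      push_cast
      ring
    rw [hderiv]
    refine quadratic_ne_zero ?_ ?_ ?_
    · rw [abs_le]
      -- The derivative is the limiting quadratic of the criterion at `t = 0`, so its coefficient
      -- bounds are limits of `h1` and `h2`. With `c := 0` the third term drops out.
      have e1 := sin_comb_deriv_nonneg (a := 1) (b := y) (c := 0) (m := 1 + 2 * T) (n := 1)
        fun t h0 hπ => by linarith [(abs_le.1 (h1 t h0 hπ)).1]
      have e2 := sin_comb_deriv_nonneg (a := 1) (b := -y) (c := 0) (m := 1 + 2 * T) (n := 1)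
        fun t h0 hπ => by linarith [(abs_le.1 (h1 t h0 hπ)).2]
      constructor <;> linarith
    · rw [abs_le]
      have e1 := sin_comb_deriv_nonneg (a := 1) (b := y) (c := x) (m := 1 + 2 * T) (n := 1 + T)
        fun t h0 hπ => by linarith [(abs_le.1 (h2 t h0 hπ)).1]
      have e2 := sin_comb_deriv_nonneg (a := 1) (b := y) (c := -x) (m := 1 + 2 * T) (n := 1 + T)
        fun t h0 hπ => by linarith [(abs_le.1 (h2 t h0 hπ)).2]
      constructor <;> linarith
    · rw [norm_pow]; exact pow_lt_one₀ (norm_nonneg _) hz (by omega)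
  · intro u v hu huv huv'
    by_contra hne
    have hv0 : v ≠ 0 := by
      rintro rfl
      exact hne (norm_eq_zero.1 (by simpa using huv))
    -- Half the argument of `u / v`; a negative argument is shifted by `2π` so that `t` lands in
    -- `(0, π)`.
    obtain ⟨t, ht0, htπ, ht⟩ : ∃ t : ℝ, 0 < t ∧ t < Real.pi ∧
        u = v * Complex.exp (t * Complex.I) ^ 2 := by
      have hn : ‖u / v‖ = 1 := by rw [norm_div, huv, div_self (norm_ne_zero_iff.2 hv0)]
      have hexp := Complex.norm_mul_exp_arg_mul_I (u / v)
      rw [hn, Complex.ofReal_one, one_mul] at hexp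
      have harg0 : (u / v).arg ≠ 0 := by
        intro h
        rw [h] at hexp
        simp at hexp
        exact hne ((div_eq_one_iff_eq hv0).1 hexp.symm)
      have hu' : u = v * (u / v) := by field_simp
      rcases lt_or_gt_of_ne harg0 with h | h
      · refine ⟨(u / v).arg / 2 + Real.pi, by linarith [Complex.neg_pi_lt_arg (u / v)],
          by linarith, ?_⟩
        rw [← Complex.exp_nat_mul]
        push_cast
        rw [show (2 : ℂ) * (((u / v).arg / 2 + Real.pi) * Complex.I) =
          (u / v).arg * Complex.I + 2 * Real.pi * Complex.I by ring, Complex.exp_add,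
          Complex.exp_two_pi_mul_I, mul_one, hexp]
        exact hu'
      · refine ⟨(u / v).arg / 2, by linarith,
          by linarith [Complex.arg_le_pi (u / v), Real.pi_pos], ?_⟩
        rw [← Complex.exp_nat_mul]
        push_cast
        rw [show (2 : ℂ) * (((u / v).arg / 2) * Complex.I) =
          (u / v).arg * Complex.I by ring, hexp]
        exact hu'
    have hs : 0 < Real.sin t := Real.sin_pos_of_pos_of_lt_pi ht0 htπ
    have hsub := trinomialT_sub T x y t (v * Complex.exp (t * Complex.I))
    rw [mul_assoc v _ (Complex.exp (-_)), ← Complex.exp_add, add_neg_cancel, Complex.exp_zero,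
      mul_one, mul_assoc v, ← pow_two, ← ht, huv', sub_self, eq_comm, mul_eq_zero] at hsub
    have hq := hsub.resolve_left (by simp [hv0])
    have hw : ‖(v * Complex.exp (t * Complex.I)) ^ T‖ < 1 := by
      rw [norm_pow, norm_mul, Complex.norm_exp_ofReal_mul_I, mul_one, ← huv]
      exact pow_lt_one₀ (norm_nonneg _) hu (by omega)
    refine quadratic_ne_zero (b := x * Real.sin ((1 + T) * t) / Real.sin t)
      (c := y * Real.sin ((1 + 2 * T) * t) / Real.sin t) ?_ ?_ hw ?_
    · rw [abs_div, abs_of_pos hs, div_le_one hs]; exact h1 t ht0 htπ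
    · rw [abs_div, abs_of_pos hs, div_le_iff₀ hs, add_mul (1 : ℝ) (_ / _), div_mul_cancel₀ _ hs.ne', one_mul]
      exact h2 t ht0 htπ
    · have hsC : (Real.sin t : ℂ) ≠ 0 := by exact_mod_cast hs.ne'
      rw [← mul_right_inj' hsC, mul_zero, ← hq]
      push_cast at hsC ⊢
      field_simp

/-! ### The trigonometric inequality behind the univalence of `S` and `Q`. -/

theorem abs_sin_nat_mul_le (n : ℕ) (t : ℝ) : |Real.sin (n * t)| ≤ n * |Real.sin t| := by
  induction n with
  | zero => simp
  | succ n ih =>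
    push_cast
    rw [add_mul, one_mul, Real.sin_add]
    calc _ ≤ |Real.sin (n * t)| * |Real.cos t| + |Real.cos (n * t)| * |Real.sin t| := by
          rw [← abs_mul, ← abs_mul]; exact abs_add_le _ _
      _ ≤ n * |Real.sin t| * 1 + 1 * |Real.sin t| := by
          gcongr
          · exact Real.abs_cos_le_one t
          · exact Real.abs_cos_le_one _
      _ = _ := by ring

/-- The derivative is factored to expose its sign: for `0 < t < π` the last factor is nonnegative by
`abs_sin_nat_mul_le`, so only `cos((1+T)t)` matters. -/
theorem hasDerivAt_sin_ratio (T : ℕ) {t : ℝ} (h : Real.sin ((1 + T) * t) ≠ 0) :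
    HasDerivAt (fun t => T * (Real.sin t / Real.sin ((1 + T) * t)) + Real.cos (T * t))
      (-(T * Real.cos ((1 + T) * t) / Real.sin ((1 + T) * t) ^ 2 *
        ((1 + 2 * T) * Real.sin t - Real.sin ((1 + 2 * T) * t)) / 2)) t := by
  have hd : ∀ a : ℝ, HasDerivAt (fun t => a * t) a t := fun a => by
    simpa using (hasDerivAt_id t).const_mul a
  have key := (((Real.hasDerivAt_sin t).div (hd (1 + T)).sin h).const_mul (T : ℝ)).add
    (hd T).cos
  refine key.congr_deriv ?_
  have e1 : Real.sin (T * t) = Real.sin ((1 + T) * t) * Real.cos t -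
      Real.cos ((1 + T) * t) * Real.sin t := by
    rw [← Real.sin_sub]; congr 1; ring
  have e2 : Real.sin ((1 + 2 * T) * t) = 2 * Real.sin ((1 + T) * t) * (Real.cos ((1 + T) * t) *
      Real.cos t + Real.sin ((1 + T) * t) * Real.sin t) - Real.sin t := by
    rw [show (1 + 2 * (T : ℝ)) * t = 2 * ((1 + T) * t) - t by ring, Real.sin_sub,
      Real.sin_two_mul, Real.cos_two_mul']
    linear_combination (-Real.sin t) * Real.sin_sq_add_cos_sq ((1 + T) * t)
  rw [e1, e2]
  have e3 := Real.sin_sq_add_cos_sq ((1 + T) * t)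
  generalize Real.sin ((1 + T) * t) = S at *
  generalize Real.cos ((1 + T) * t) = C at *
  field_simp
  linear_combination (-2 * S * Real.cos t * T) * e3

/-- The right side decreases until `(1+T)t = π/2` and increases afterwards; its minimum, at `α`, is
the left side because `Tα = π/2 - α`. -/
theorem sin_ratio_ge {T : ℕ} (hT : 1 ≤ T) {t : ℝ} (ht0 : 0 < t) (ht : (1 + T) * t < Real.pi) :
    (1 + T) * Real.sin (Real.pi / (2 + 2 * T)) ≤
      T * (Real.sin t / Real.sin ((1 + T) * t)) + Real.cos (T * t) := by
  set f : ℝ → ℝ := fun t => T * (Real.sin t / Real.sin ((1 + T) * t)) + Real.cos (T * t) with hf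
  set α := Real.pi / (2 + 2 * T) with hα
  have hN : (0 : ℝ) < 1 + T := by positivity
  have hα0 : 0 < α := by positivity
  have hNα : (1 + T) * α = Real.pi / 2 := by rw [hα]; field_simp
  have hfα : f α = (1 + T) * Real.sin α := by
    have : Real.cos (T * α) = Real.sin α := by
      rw [← Real.cos_pi_div_two_sub, ← hNα]; congr 1; ring
    simp only [hf]
    rw [hNα, this, Real.sin_pi_div_two]; ring
  have hspos : ∀ t, 0 < t → (1 + T) * t < Real.pi → 0 < Real.sin ((1 + T) * t) :=
    fun t h0 h => Real.sin_pos_of_pos_of_lt_pi (by positivity) h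
  have htπ : ∀ t, 0 < t → (1 + T) * t < Real.pi → t < Real.pi := fun t h0 h => by
    nlinarith [show (0 : ℝ) ≤ T by positivity]
  have hfac : ∀ t, 0 < t → (1 + T) * t < Real.pi →
      0 ≤ (1 + 2 * T) * Real.sin t - Real.sin ((1 + 2 * T) * t) := fun t h0 h => by
    have h1 := abs_sin_nat_mul_le (1 + 2 * T) t
    rw [abs_of_pos (Real.sin_pos_of_pos_of_lt_pi h0 (htπ t h0 h))] at h1
    push_cast at h1
    linarith [le_abs_self (Real.sin ((1 + 2 * T) * t))]
  have hder : ∀ t, 0 < t → (1 + T) * t < Real.pi → HasDerivAt f _ t := fun t h0 h =>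
    hasDerivAt_sin_ratio T (hspos t h0 h).ne'
  rw [← hfα]
  rcases le_total t α with h | h
  · have hlt : ∀ u, u ≤ α → (1 + T) * u < Real.pi := fun u hu => by
      have := mul_le_mul_of_nonneg_left hu hN.le
      linarith [Real.pi_pos]
    refine antitoneOn_of_deriv_nonpos (D := Set.Ioc 0 α) (convex_Ioc _ _) ?_ ?_ ?_
      ⟨ht0, h⟩ ⟨hα0, le_rfl⟩ h
    · exact fun u hu => (hder u hu.1 (hlt u hu.2)).continuousAt.continuousWithinAt
    · rw [interior_Ioc]
      exact fun u hu => (hder u hu.1 (hlt u hu.2.le)).differentiableAt.differentiableWithinAt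
    · rw [interior_Ioc]
      intro u hu
      rw [(hder u hu.1 (hlt u hu.2.le)).deriv, neg_nonpos]
      have h1 := hfac u hu.1 (hlt u hu.2.le)
      have h2 : 0 ≤ Real.cos ((1 + T) * u) := by
        have := mul_le_mul_of_nonneg_left hu.2.le hN.le
        have := mul_pos hN hu.1
        exact Real.cos_nonneg_of_mem_Icc ⟨by linarith, by linarith⟩
      positivity
  · have hα' : (1 + T) * α < Real.pi := by rw [hNα]; linarith [Real.pi_pos]
    have hlt : ∀ u, u ≤ t → (1 + T) * u < Real.pi := fun u hu =>
      (mul_le_mul_of_nonneg_left hu hN.le).trans_lt ht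
    refine monotoneOn_of_deriv_nonneg (D := Set.Icc α t) (convex_Icc _ _) ?_ ?_ ?_
      ⟨le_rfl, h⟩ ⟨h, le_rfl⟩ h
    · exact fun u hu =>
        (hder u (hα0.trans_le hu.1) (hlt u hu.2)).continuousAt.continuousWithinAt
    · rw [interior_Icc]
      exact fun u hu =>
        (hder u (hα0.trans hu.1) (hlt u hu.2.le)).differentiableAt.differentiableWithinAt
    · rw [interior_Icc]
      intro u hu
      have hu0 := hα0.trans hu.1
      rw [(hder u hu0 (hlt u hu.2.le)).deriv, neg_nonneg]
      have h1 := hfac u hu0 (hlt u hu.2.le)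
      have h2 : Real.cos ((1 + T) * u) ≤ 0 := by
        have := mul_le_mul_of_nonneg_left hu.1.le hN.le
        exact Real.cos_nonpos_of_pi_div_two_le_of_le (by linarith)
          (by linarith [hlt u hu.2.le, Real.pi_pos])
      exact div_nonpos_of_nonpos_of_nonneg (mul_nonpos_of_nonpos_of_nonneg
        (div_nonpos_of_nonpos_of_nonneg
          (mul_nonpos_of_nonneg_of_nonpos (Nat.cast_nonneg T) h2) (sq_nonneg _)) h1) zero_le_two

/-- This is `sin_ratio_ge` cleared of its denominator, by `sin((1+2T)t) + sin t = 2 sin((1+T)t)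
cos(Tt)`. -/
theorem sin_inequality_of_lt {T : ℕ} (hT : 1 ≤ T) {t : ℝ} (ht0 : 0 < t)
    (ht : (1 + T) * t < Real.pi) :
    2 * (1 + T) * Real.sin (Real.pi / (2 + 2 * T)) * |Real.sin ((1 + T) * t)| ≤
      (1 + 2 * T) * Real.sin t + Real.sin ((1 + 2 * T) * t) := by
  have hs : 0 < Real.sin ((1 + T) * t) := Real.sin_pos_of_pos_of_lt_pi (by positivity) ht
  have h := mul_le_mul_of_nonneg_right (sin_ratio_ge hT ht0 ht) hs.le
  have e : Real.sin ((1 + 2 * T) * t) + Real.sin t = 2 * Real.sin ((1 + T) * t) * Real.cos (T * t) := by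
    rw [show (1 + 2 * (T : ℝ)) * t = (1 + T) * t + T * t by ring, Real.sin_add]
    have e' : Real.sin t = Real.sin ((1 + T) * t - T * t) := by congr 1; ring
    rw [e', Real.sin_sub]; ring
  rw [add_mul (_ * _), mul_assoc (T : ℝ), div_mul_cancel₀ _ hs.ne'] at h
  rw [abs_of_pos hs]
  linarith

/-- Away from `0` and `π` there is room to replace the oscillating sines by `1` and `-1`, using only
`sin t ≥ sin 2α`. -/
theorem sin_inequality_of_middle {T : ℕ} (hT : 2 ≤ T) {t : ℝ}
    (ht : Real.sin (Real.pi / (1 + T)) ≤ Real.sin t) :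
    2 * (1 + T) * Real.sin (Real.pi / (2 + 2 * T)) * |Real.sin ((1 + T) * t)| ≤
      (1 + 2 * T) * Real.sin t + Real.sin ((1 + 2 * T) * t) := by
  set α := Real.pi / (2 + 2 * T) with hα
  have hT' : (2 : ℝ) ≤ T := by exact_mod_cast hT
  have hα0 : 0 < α := by positivity
  have hNα : (1 + T) * α = Real.pi / 2 := by rw [hα]; field_simp
  have hα1 : α ≤ Real.pi / 6 := by
    rw [hα]; gcongr; linarith
  have hπ := Real.pi_gt_d2
  have hπ' := Real.pi_lt_d2
  -- From `α ≤ π/6`. Then `sin α ≥ α(1 - α²/6) ≥ 0.93 α`, `cos α ≥ 1 - 0.14 = 0.86`, and `(1+T) sin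
  -- α ≥ 0.93 · π/2 ≥ 1.4`.
  have hα2 : α ^ 2 ≤ 0.28 := by nlinarith
  have hsin : α - α ^ 3 / 6 < Real.sin α := Real.sin_gt_sub_cube hα0
  have hsin' : 0.93 * α ≤ Real.sin α := by nlinarith
  have hcos := Real.one_sub_sq_div_two_le_cos (x := α)
  have hN : 1.4 ≤ (1 + T) * Real.sin α := by nlinarith
  have hs0 : 0 < Real.sin α := by nlinarith
  have h2 : Real.sin (Real.pi / (1 + T)) = 2 * Real.sin α * Real.cos α := by
    rw [← Real.sin_two_mul, hα]; congr 1; field_simp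
  rw [h2] at ht
  have h3 : |Real.sin ((1 + T) * t)| ≤ 1 := Real.abs_sin_le_one _
  have h4 := Real.neg_one_le_sin ((1 + 2 * T) * t)
  calc _ ≤ 2 * (1 + T) * Real.sin α * 1 := by gcongr
    _ ≤ (1 + 2 * T) * (2 * Real.sin α * 0.86) - 1 := by nlinarith
    _ ≤ (1 + 2 * T) * (2 * Real.sin α * Real.cos α) - 1 := by gcongr; linarith
    _ ≤ (1 + 2 * T) * Real.sin t + Real.sin ((1 + 2 * T) * t) := by
      have := mul_le_mul_of_nonneg_left ht (show (0 : ℝ) ≤ 1 + 2 * T by positivity)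
      linarith

theorem sin_inequality {T : ℕ} (hT : 1 ≤ T) {t : ℝ} (ht0 : 0 < t) (htπ : t < Real.pi) :
    2 * (1 + T) * Real.sin (Real.pi / (2 + 2 * T)) * |Real.sin ((1 + T) * t)| ≤
      (1 + 2 * T) * Real.sin t + Real.sin ((1 + 2 * T) * t) := by
  have hN : (0 : ℝ) < 1 + T := by positivity
  by_cases h1 : (1 + T) * t < Real.pi
  · exact sin_inequality_of_lt hT ht0 h1
  by_cases h2 : (1 + T) * (Real.pi - t) < Real.pi
  -- Under `t ↦ π - t`, `sin((1+2T)t)` is unchanged since `1+2T` is odd, and `sin((1+T)t)` changes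
  -- at most its sign.
  · have h := sin_inequality_of_lt hT (sub_pos.2 htπ) h2
    have e1 := Real.sin_nat_mul_pi_sub ((1 + T) * t) (1 + T)
    have e2 := Real.sin_nat_mul_pi_sub ((1 + 2 * T) * t) (1 + 2 * T)
    rw [pow_add, pow_mul, neg_one_sq, one_pow] at e2
    push_cast at e1 e2
    rw [← mul_sub] at e1 e2
    rw [e1, e2, Real.sin_pi_sub, abs_neg, abs_mul, abs_pow, abs_neg, abs_one, one_pow, one_mul] at h
    linarith
  push Not at h1 h2
  -- For `T = 1` the middle range is the single point `π/2`, where equality holds.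
  rcases hT.eq_or_lt with rfl | hT2
  · push_cast at *
    obtain rfl : t = Real.pi / 2 := by linarith
    rw [show (1 + 1) * (Real.pi / 2) = Real.pi by ring,
      show (1 + 2 * 1) * (Real.pi / 2) = Real.pi / 2 + Real.pi by ring, Real.sin_add_pi]
    norm_num
  · refine sin_inequality_of_middle hT2 ?_
    have h3 : Real.pi / (1 + T) ≤ t := by rw [div_le_iff₀ hN]; linarith
    have h4 : Real.pi / (1 + T) ≤ Real.pi - t := by rw [div_le_iff₀ hN]; linarith
    have h5 : 0 < Real.pi / (1 + T) := by positivity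
    rcases le_total t (Real.pi / 2) with h | h
    · exact Real.sin_le_sin_of_le_of_le_pi_div_two (by linarith) h h3
    · rw [← Real.sin_pi_sub t]
      exact Real.sin_le_sin_of_le_of_le_pi_div_two (by linarith) (by linarith) h4

/-! ### Coefficients, rotation by `e^{iπ/T}` and maximum modulus. -/

theorem coeff_trinomialT (T : ℕ) (x y : ℝ) (k : ℕ) :
    (trinomialT T x y).coeff k =
      (if k = 1 then 1 else 0) + (if k = 1 + T then x else 0) + if k = 1 + 2 * T then y else 0 := by
  simp only [trinomialT, coeff_add, coeff_X, coeff_C_mul, coeff_X_pow, mul_ite, mul_one, mul_zero,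
    eq_comm (a := 1) (b := k)]

theorem coeff_trinomialT_middle {T : ℕ} (hT : 1 ≤ T) (x y : ℝ) :
    (trinomialT T x y).coeff (1 + T) = x := by
  rw [coeff_trinomialT, if_neg (by omega), if_pos rfl, if_neg (by omega)]; ring

theorem coeff_trinomialT_top {T : ℕ} (hT : 1 ≤ T) (x y : ℝ) :
    (trinomialT T x y).coeff (1 + 2 * T) = y := by
  rw [coeff_trinomialT, if_neg (by omega), if_neg (by omega), if_pos rfl]; ring

theorem eval_one_trinomialT (T : ℕ) (x y : ℝ) : (trinomialT T x y).eval 1 = 1 + x + y := by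
  simp [trinomialT]

theorem exp_pi_div_pow {T : ℕ} (hT : 1 ≤ T) : Complex.exp (Complex.I * Real.pi / T) ^ T = -1 := by
  have : (T : ℂ) ≠ 0 := by exact_mod_cast (by omega : T ≠ 0)
  rw [← Complex.exp_nat_mul, mul_div_cancel₀ _ this, mul_comm, Complex.exp_pi_mul_I]

theorem norm_exp_pi_div (T : ℕ) : ‖Complex.exp (Complex.I * Real.pi / T)‖ = 1 := by
  rw [show Complex.I * Real.pi / T = ((Real.pi / T : ℝ) : ℂ) * Complex.I by push_cast; ring]
  exact Complex.norm_exp_ofReal_mul_I _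

/-- Since `(e^{iπ/T})^T = -1`, the rotation only flips the sign of `x`; hence `Q` is `S` with `x`
negated. -/
theorem aeval_exp_pi_div_mul {T : ℕ} (hT : 1 ≤ T) (x y : ℝ) (z : ℂ) :
    aeval (Complex.exp (Complex.I * Real.pi / T) * z) (trinomialT T x y) =
      Complex.exp (Complex.I * Real.pi / T) * aeval z (trinomialT T (-x) y) := by
  simp only [aeval_trinomialT, mul_pow, pow_add, pow_one, mul_comm 2 T, pow_mul,
    exp_pi_div_pow hT]
  push_cast
  ring

theorem norm_aeval_exp_pi_div {T : ℕ} (hT : 1 ≤ T) (x y : ℝ) :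
    ‖aeval (Complex.exp (Complex.I * Real.pi / T)) (trinomialT T x y)‖ = |1 - x + y| := by
  have h := aeval_exp_pi_div_mul hT x y 1
  rw [mul_one] at h
  rw [h, norm_mul, norm_exp_pi_div, one_mul, aeval_trinomialT]
  simp only [one_pow, mul_one]
  rw [show (1 : ℂ) + ((-x : ℝ) : ℂ) + y = ((1 - x + y : ℝ) : ℂ) by push_cast; ring,
    Complex.norm_real, Real.norm_eq_abs]

theorem angularRatio_trinomialT {T : ℕ} (hT : 1 ≤ T) (x y : ℝ) :
    angularRatio T (trinomialT T x y) = |1 - x + y| / (1 + x + y) := by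
  rw [angularRatio, norm_aeval_exp_pi_div hT, eval_one_trinomialT]

theorem norm_aeval_trinomialT_le (T : ℕ) (x y : ℝ) {z : ℂ} (hz : ‖z‖ ≤ 1) :
    ‖aeval z (trinomialT T x y)‖ ≤ 1 + |x| + |y| := by
  have hp : ∀ n, ‖z‖ ^ n ≤ 1 := fun n => pow_le_one₀ (norm_nonneg z) hz
  rw [aeval_trinomialT]
  refine (norm_add₃_le).trans ?_
  rw [norm_mul, norm_mul, norm_pow, norm_pow, Complex.norm_real, Complex.norm_real,
    Real.norm_eq_abs, Real.norm_eq_abs]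
  exact add_le_add (add_le_add hz (mul_le_of_le_one_right (abs_nonneg x) (hp _)))
    (mul_le_of_le_one_right (abs_nonneg y) (hp _))

theorem maxModulus_trinomialT_le (T : ℕ) (x y : ℝ) :
    maxModulus (trinomialT T x y) ≤ 1 + |x| + |y| := by
  refine csSup_le ⟨_, 0, by simp, rfl⟩ ?_
  rintro _ ⟨z, hz, rfl⟩
  exact norm_aeval_trinomialT_le T x y (by simpa using hz)

theorem le_maxModulus_trinomialT (T : ℕ) (x y : ℝ) {z : ℂ} (hz : ‖z‖ ≤ 1) :
    ‖aeval z (trinomialT T x y)‖ ≤ maxModulus (trinomialT T x y) := by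
  refine le_csSup ⟨1 + |x| + |y|, ?_⟩ ⟨z, by simpa using hz, rfl⟩
  rintro _ ⟨z, hz, rfl⟩
  exact norm_aeval_trinomialT_le T x y (by simpa using hz)

/-- The triangle inequality is sharp at `1` if `x ≥ 0` and at `e^{iπ/T}` if `x ≤ 0`. -/
theorem maxModulus_trinomialT {T : ℕ} (hT : 1 ≤ T) {x y : ℝ} (hy : 0 ≤ y) :
    maxModulus (trinomialT T x y) = 1 + |x| + y := by
  refine le_antisymm ((maxModulus_trinomialT_le T x y).trans_eq (by rw [abs_of_nonneg hy])) ?_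
  rcases le_total 0 x with hx | hx
  · refine le_trans ?_ (le_maxModulus_trinomialT T x y (z := 1) (by simp))
    rw [aeval_trinomialT, one_pow, one_pow, mul_one, mul_one, ← Complex.ofReal_one,
      ← Complex.ofReal_add, ← Complex.ofReal_add, Complex.norm_real, abs_of_nonneg hx]
    exact Real.le_norm_self _
  · refine le_trans ?_ (le_maxModulus_trinomialT T x y (norm_exp_pi_div T).le)
    rw [norm_aeval_exp_pi_div hT, abs_of_nonpos hx]
    exact le_abs_self _

/-! ### The Suffridge trinomial and the bounds on `x` and `y`. -/

section Bounds

variable {T : ℕ}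

theorem sin_suffridge_pos (hT : 1 ≤ T) : 0 < Real.sin (Real.pi / (2 + 2 * T)) := by
  have h : (1 : ℝ) ≤ T := by exact_mod_cast hT
  refine Real.sin_pos_of_pos_of_lt_pi (by positivity) (div_lt_self Real.pi_pos (by linarith))

theorem cos_suffridge_pos (hT : 1 ≤ T) : 0 < Real.cos (Real.pi / (2 + 2 * T)) := by
  have h : (1 : ℝ) ≤ T := by exact_mod_cast hT
  have h0 : 0 < Real.pi / (2 + 2 * T) := by positivity
  refine Real.cos_pos_of_mem_Ioo ⟨by linarith [Real.pi_pos], ?_⟩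
  exact div_lt_div_of_pos_left Real.pi_pos two_pos (by linarith)

theorem sin_suffridge_lt_one (hT : 1 ≤ T) : Real.sin (Real.pi / (2 + 2 * T)) < 1 := by
  nlinarith [cos_suffridge_pos hT, sin_suffridge_pos hT,
    Real.sin_sq_add_cos_sq (Real.pi / (2 + 2 * T))]

/-- The explicit form of the Suffridge trinomial. -/
theorem suffridgeT_three (hT : 1 ≤ T) :
    suffridgeT T 3 =
      trinomialT T (2 * (1 + (T : ℝ)) / (1 + 2 * (T : ℝ)) * Real.sin (Real.pi / (2 + 2 * (T : ℝ))))
        (1 / (1 + 2 * (T : ℝ))) := by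
  have h : (1 : ℝ) ≤ T := by exact_mod_cast hT
  have hd : (0 : ℝ) < 2 + 2 * T := by positivity
  set α := Real.pi / (2 + 2 * (T : ℝ)) with hα
  -- The four angles are `2α`, `Tα = π/2 - α`, `(2+T)α = π - Tα` and `2Tα = π - 2α`.
  have e1 : Real.sin (Real.pi * 2 / (2 + T * 2)) = 2 * Real.sin α * Real.cos α := by
    rw [← Real.sin_two_mul, hα]; congr 1; ring
  have e2 : Real.sin (Real.pi * T / (2 + T * 2)) = Real.cos α := by
    rw [← Real.cos_pi_div_two_sub, hα]; congr 1; field_simp; ring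
  have e3 : Real.sin (Real.pi * (2 + T) / (2 + T * 2)) = Real.cos α := by
    rw [← e2, ← Real.sin_pi_sub]; congr 1; field_simp; ring
  have e4 : Real.sin (Real.pi * T * 2 / (2 + T * 2)) = 2 * Real.sin α * Real.cos α := by
    rw [← e1, ← Real.sin_pi_sub]; congr 1; field_simp; ring
  have hs := (sin_suffridge_pos hT).ne'
  have hc := (cos_suffridge_pos hT).ne'
  rw [← hα] at hs hc
  rw [suffridgeT, show Finset.Icc 2 3 = {2, 3} from rfl, Finset.sum_pair (by norm_num),
    show Finset.Icc 1 (2 - 1) = {1} from rfl, show Finset.Icc 1 (3 - 1) = {1, 2} from rfl,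
    Finset.prod_singleton, Finset.prod_pair (by norm_num), trinomialT, ← add_assoc]
  norm_num only [Nat.cast_one, Nat.cast_ofNat, mul_one, mul_zero, add_zero, one_mul]
  rw [e1, e2, e3, e4, add_comm T 1, add_comm (T * 2) 1, mul_comm T 2]
  congr 3
  · congr 1
    field_simp
    ring
  · field_simp
    ring

/-- Only `|x|` enters the criterion, so `S` and `Q` are handled together. -/
theorem univalentTrinomials_of_abs_eq (hT : 1 ≤ T) {x : ℝ}
    (hx : |x| = 2 * (1 + (T : ℝ)) / (1 + 2 * T) * Real.sin (Real.pi / (2 + 2 * T))) :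
    trinomialT T x (1 / (1 + 2 * T)) ∈ univalentTrinomials T := by
  have hd : (0 : ℝ) < 1 + 2 * T := by positivity
  refine dieudonne_sufficient hT (fun t h0 hπ => ?_) (fun t h0 hπ => ?_)
  · have h := abs_sin_nat_mul_le (1 + 2 * T) t
    rw [abs_of_pos (Real.sin_pos_of_pos_of_lt_pi h0 hπ)] at h
    push_cast at h
    rw [abs_mul, abs_of_pos (by positivity), one_div_mul_eq_div, div_le_iff₀ hd]
    linarith
  · have h := sin_inequality hT h0 hπ
    rw [abs_mul, hx, ← mul_le_mul_iff_right₀ hd]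
    calc _ = _ := by field_simp
      _ ≤ _ := h
      _ = _ := by field_simp

theorem sin_suffridge_top (T : ℕ) : Real.sin ((1 + 2 * T) * (Real.pi / (2 + 2 * T))) =
    Real.sin (Real.pi / (2 + 2 * T)) := by
  rw [← Real.sin_pi_sub]; congr 1; field_simp; ring

theorem suffridge_angle_mul (T : ℕ) : (1 + T) * (Real.pi / (2 + 2 * T)) = Real.pi / 2 := by
  field_simp

theorem abs_middle_le (hT : 1 ≤ T) {x y : ℝ} (h : trinomialT T x y ∈ univalentTrinomials T) :
    |x| ≤ Real.sin (Real.pi / (2 + 2 * T)) * (1 + y) := by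
  have hT' : (1 : ℝ) ≤ T := by exact_mod_cast hT
  have := (dieudonne_necessary hT h (t := Real.pi / (2 + 2 * T)) (by positivity)
    (div_lt_self Real.pi_pos (by linarith))).2
  rw [suffridge_angle_mul, Real.sin_pi_div_two, mul_one, sin_suffridge_top] at this
  linarith

theorem abs_top_le (hT : 1 ≤ T) {x y : ℝ} (h : trinomialT T x y ∈ univalentTrinomials T) :
    |y| ≤ 1 / (1 + 2 * T) := by
  have hd : (0 : ℝ) < 1 + 2 * T := by positivity
  have h1 := fun t h0 hπ => abs_le.1 (dieudonne_necessary hT h (t := t) h0 hπ).1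
  have e1 := sin_comb_deriv_nonneg (a := 1) (b := y) (c := 0) (m := 1 + 2 * T) (n := 1)
    fun t h0 hπ => by linarith [(h1 t h0 hπ).1]
  have e2 := sin_comb_deriv_nonneg (a := 1) (b := -y) (c := 0) (m := 1 + 2 * T) (n := 1)
    fun t h0 hπ => by linarith [(h1 t h0 hπ).2]
  rw [le_div_iff₀ hd, ← abs_of_pos hd, ← abs_mul, abs_le]
  constructor <;> linarith

theorem one_add_top_pos (hT : 1 ≤ T) {x y : ℝ} (h : trinomialT T x y ∈ univalentTrinomials T) :
    0 < 1 + y := by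
  have hT' : (1 : ℝ) ≤ T := by exact_mod_cast hT
  have h1 := abs_top_le hT h
  have h2 : 1 / (1 + 2 * (T : ℝ)) < 1 := by rw [div_lt_one (by positivity)]; linarith
  linarith [neg_abs_le y]

/-- In the extremal case of `abs_middle_le` the leading coefficient is determined. -/
theorem top_eq_of_middle_eq (hT : 1 ≤ T) {x y : ℝ}
    (h : trinomialT T x y ∈ univalentTrinomials T)
    (hx : x = Real.sin (Real.pi / (2 + 2 * T)) * (1 + y)) : y = 1 / (1 + 2 * T) := by
  have hT' : (1 : ℝ) ≤ T := by exact_mod_cast hT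
  set α := Real.pi / (2 + 2 * (T : ℝ)) with hα
  have hα0 : 0 < α := by positivity
  have hαπ : α < Real.pi := div_lt_self Real.pi_pos (by linarith)
  have hd : (0 : ℝ) < 1 + 2 * T := by positivity
  have hcosα : Real.cos ((1 + 2 * T) * α) = -Real.cos α := by
    rw [← Real.cos_pi_sub, hα]; congr 1; field_simp; ring
  -- The function is nonnegative on `(0, π)` by the criterion and zero at `α`. Its derivative there
  -- is `cos α · (1 - (1+2T)y)`.
  have hmin : IsLocalMin (fun t => 1 * Real.sin t + y * Real.sin ((1 + 2 * T) * t) +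
      -x * Real.sin ((1 + T) * t)) α := by
    filter_upwards [Ioo_mem_nhds hα0 hαπ] with t ht
    rw [suffridge_angle_mul, sin_suffridge_top, Real.sin_pi_div_two, hx]
    have := (le_abs_self _).trans (dieudonne_necessary hT h ht.1 ht.2).2
    rw [hx] at this
    linarith
  have hder := hmin.hasDerivAt_eq_zero (hasDerivAt_sin_comb _ _ _ _ _ _)
  rw [suffridge_angle_mul, Real.cos_pi_div_two, hcosα] at hder
  have hc : Real.cos α ≠ 0 := (cos_suffridge_pos hT).ne'
  rw [eq_div_iff hd.ne']
  refine mul_left_cancel₀ hc ?_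
  linarith

end Bounds

/-! ### The extremal problems. -/

theorem mainTheorem2 (T : ℕ) (hT : 1 ≤ T) :
    -- the explicit form of `S^(T)` for `n = 3`, and its membership in the class
    suffridgeT T 3 =
        trinomialT T (2 * (1 + (T : ℝ)) / (1 + 2 * (T : ℝ)) * Real.sin (Real.pi / (2 + 2 * (T : ℝ))))
          (1 / (1 + 2 * (T : ℝ))) ∧
    suffridgeT T 3 ∈ univalentTrinomials T ∧
    -- the rotated polynomial `Q(z) = e^{-iπ/T} S^(T)(e^{iπ/T} z)` has real coefficients
    ∃ Q : Polynomial ℝ,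
      (∀ z : ℂ, Polynomial.aeval z Q =
        Complex.exp (-(Complex.I * Real.pi / T)) *
          Polynomial.aeval (Complex.exp (Complex.I * Real.pi / T) * z) (suffridgeT T 3)) ∧
      (Odd T → Q = -(suffridgeT T 3).comp (-Polynomial.X)) ∧
      Q ∈ univalentTrinomials T ∧
      Q.coeff (1 + 2 * T) = 1 / (1 + 2 * (T : ℝ)) ∧
      -- largest coefficients among trinomials with leading coefficient `1 / (1 + 2T)`
      (∀ P ∈ univalentTrinomials T, P.coeff (1 + 2 * T) = 1 / (1 + 2 * (T : ℝ)) →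
        (∀ k : ℕ, |P.coeff k| ≤ (suffridgeT T 3).coeff k) ∧
        (|P.coeff (1 + T)| = (suffridgeT T 3).coeff (1 + T) ↔ P = suffridgeT T 3 ∨ P = Q)) ∧
      -- largest maximum modulus
      IsGreatest (maxModulus '' univalentTrinomials T) ((suffridgeT T 3).eval 1) ∧
      (∀ P ∈ univalentTrinomials T,
        maxModulus P = (suffridgeT T 3).eval 1 ↔ P = suffridgeT T 3 ∨ P = Q) ∧
      -- smallest quotient `|P(e^{iπ/T})| / P(1)`
      (∀ P ∈ univalentTrinomials T, 0 < P.eval 1) ∧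
      IsLeast (angularRatio T '' univalentTrinomials T) (angularRatio T (suffridgeT T 3)) ∧
      angularRatio T (suffridgeT T 3) =
        ((1 - Real.sin (Real.pi / (2 + 2 * (T : ℝ)))) /
          Real.cos (Real.pi / (2 + 2 * (T : ℝ)))) ^ 2 ∧
      (∀ P ∈ univalentTrinomials T,
        angularRatio T P = angularRatio T (suffridgeT T 3) ↔ P = suffridgeT T 3) := by
  rw [suffridgeT_three hT]
  have hT' : (1 : ℝ) ≤ T := by exact_mod_cast hT
  have hs0 := sin_suffridge_pos hT
  have hs1 := sin_suffridge_lt_one hT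
  have hc0 := cos_suffridge_pos hT
  have hsc := Real.sin_sq_add_cos_sq (Real.pi / (2 + 2 * (T : ℝ)))
  have hbound := fun x y => abs_middle_le hT (x := x) (y := y)
  have hunique := fun x y => top_eq_of_middle_eq hT (x := x) (y := y)
  have hx₀ : 2 * (1 + (T : ℝ)) / (1 + 2 * T) * Real.sin (Real.pi / (2 + 2 * (T : ℝ))) =
      Real.sin (Real.pi / (2 + 2 * (T : ℝ))) * (1 + 1 / (1 + 2 * (T : ℝ))) := by
    field_simp; ring
  have hmem := fun x => univalentTrinomials_of_abs_eq hT (x := x)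
  rw [hx₀] at hmem ⊢
  -- The trigonometry is finished: what remains is algebra with `0 < s < 1`, `|x| ≤ s(1 + y)` and
  -- `|y| ≤ y₀`.
  generalize Real.sin (Real.pi / (2 + 2 * (T : ℝ))) = s at *
  generalize Real.cos (Real.pi / (2 + 2 * (T : ℝ))) = c at *
  have htop := fun x y => abs_top_le hT (x := x) (y := y)
  have hpos := fun x y => one_add_top_pos hT (x := x) (y := y)
  have hy₀ : 0 < 1 / (1 + 2 * (T : ℝ)) := by positivity
  generalize hy : 1 / (1 + 2 * (T : ℝ)) = y₀ at *
  obtain ⟨x₀, hx⟩ : ∃ x₀, x₀ = s * (1 + y₀) := ⟨_, rfl⟩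
  rw [← hx] at hmem ⊢
  have hx0 : 0 < x₀ := by rw [hx]; positivity
  have hSm := hmem x₀ (abs_of_pos hx0)
  have hQm := hmem (-x₀) (by rw [abs_neg, abs_of_pos hx0])
  have heval : ∀ x y, trinomialT T x y ∈ univalentTrinomials T → 0 < 1 + x + y := by
    intro x y h
    nlinarith [hbound x y h, hpos x y h, neg_abs_le x]
  -- For `y ≥ 0` the sum `s(1 + y) + y` increases up to `y = y₀`; for `y < 0` the bound `s(1 + y) -
  -- y` stays strictly below the value at `y₀`.
  have hmod : ∀ x y, trinomialT T x y ∈ univalentTrinomials T →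
      1 + |x| + |y| ≤ 1 + x₀ + y₀ ∧ (1 + x₀ + y₀ ≤ 1 + |x| + |y| → y = y₀ ∧ |x| = x₀) := by
    intro x y h
    have h1 := hbound x y h
    have h2 := htop x y h
    rcases le_or_gt 0 y with h3 | h3
    · rw [abs_of_nonneg h3] at h2 ⊢
      refine ⟨by nlinarith, fun h4 => ?_⟩
      obtain rfl : y = y₀ := le_antisymm h2 (by nlinarith)
      exact ⟨rfl, by linarith⟩
    · rw [abs_of_neg h3] at h2 ⊢
      refine ⟨by nlinarith, fun h4 => absurd h4 (by nlinarith)⟩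
  have hratio : ∀ x y, trinomialT T x y ∈ univalentTrinomials T →
      angularRatio T (trinomialT T x y) = (1 + y - x) / (1 + y + x) := by
    intro x y h
    have : 0 ≤ 1 - x + y := by nlinarith [hbound x y h, hpos x y h, le_abs_self x]
    rw [angularRatio_trinomialT hT, abs_of_nonneg this]
    congr 1 <;> ring
  have hratioS : angularRatio T (trinomialT T x₀ y₀) = (1 - s) / (1 + s) := by
    rw [hratio _ _ hSm, hx]
    field_simp
  have hSQ : ∀ x, |x| = x₀ → trinomialT T x y₀ = trinomialT T x₀ y₀ ∨
      trinomialT T x y₀ = trinomialT T (-x₀) y₀ := by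
    intro x h
    rcases (abs_eq hx0.le).1 h with rfl | rfl
    · exact Or.inl rfl
    · exact Or.inr rfl
  have hmaxSQ : ∀ x, |x| = x₀ → maxModulus (trinomialT T x y₀) = 1 + x₀ + y₀ := fun x h => by
    rw [maxModulus_trinomialT hT hy₀.le, h]
  refine ⟨rfl, hSm, trinomialT T (-x₀) y₀, ?_, ?_, hQm, coeff_trinomialT_top hT _ _, ?_, ?_, ?_,
    ?_, ?_, ?_, ?_⟩
  · intro z
    rw [aeval_exp_pi_div_mul hT, ← mul_assoc, ← Complex.exp_add, neg_add_cancel, Complex.exp_zero,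
      one_mul]
  · intro hodd
    have h1 : Even (1 + T) := by rw [add_comm]; exact hodd.add_one
    have h2 : Odd (1 + 2 * T) := by rw [add_comm]; exact odd_two_mul_add_one T
    simp only [trinomialT, add_comp, mul_comp, C_comp, X_comp, X_pow_comp, h1.neg_pow, h2.neg_pow,
      C_neg]
    ring
  · rintro _ ⟨⟨x, y, rfl⟩, hinj⟩ htop'
    have h : trinomialT T x y ∈ univalentTrinomials T := ⟨⟨x, y, rfl⟩, hinj⟩
    rw [coeff_trinomialT_top hT] at htop'
    subst htop'
    have hxx : |x| ≤ x₀ := hx ▸ hbound _ _ h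
    refine ⟨fun k => ?_, ?_⟩
    · rw [coeff_trinomialT, coeff_trinomialT]
      refine (abs_add_three _ _ _).trans (add_le_add (add_le_add ?_ ?_) ?_)
      · split_ifs <;> simp
      · split_ifs <;> simp [hxx]
      · split_ifs
        · exact (abs_of_pos hy₀).le
        · simp
    · rw [coeff_trinomialT_middle hT, coeff_trinomialT_middle hT]
      refine ⟨hSQ x, ?_⟩
      rintro (h | h) <;> have := congrArg (fun P : ℝ[X] => P.coeff (1 + T)) h <;>
        simp only [coeff_trinomialT_middle hT] at this <;> rw [this]
      · exact abs_of_pos hx0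
      · rw [abs_neg, abs_of_pos hx0]
  · rw [eval_one_trinomialT]
    refine ⟨⟨_, hSm, hmaxSQ _ (abs_of_pos hx0)⟩, ?_⟩
    rintro _ ⟨_, ⟨⟨x, y, rfl⟩, hinj⟩, rfl⟩
    exact (maxModulus_trinomialT_le T x y).trans (hmod x y ⟨⟨x, y, rfl⟩, hinj⟩).1
  · rintro _ ⟨⟨x, y, rfl⟩, hinj⟩
    rw [eval_one_trinomialT]
    constructor
    · intro h
      obtain ⟨rfl, h'⟩ := (hmod x y ⟨⟨x, y, rfl⟩, hinj⟩).2
        (h ▸ maxModulus_trinomialT_le T x y)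
      exact hSQ x h'
    · rintro (h | h) <;> rw [h]
      · exact hmaxSQ _ (abs_of_pos hx0)
      · exact hmaxSQ _ (by rw [abs_neg, abs_of_pos hx0])
  · rintro _ ⟨⟨x, y, rfl⟩, hinj⟩
    rw [eval_one_trinomialT]
    exact heval x y ⟨⟨x, y, rfl⟩, hinj⟩
  · refine ⟨⟨_, hSm, rfl⟩, ?_⟩
    rintro _ ⟨_, ⟨⟨x, y, rfl⟩, hinj⟩, rfl⟩
    have h : trinomialT T x y ∈ univalentTrinomials T := ⟨⟨x, y, rfl⟩, hinj⟩
    have h1 := heval x y h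
    rw [hratioS, hratio x y h, div_le_div_iff₀ (by linarith) (by linarith)]
    -- The quotient decreases in `x / (1 + y)`, which is at most `s`.
    nlinarith [hbound x y h, le_abs_self x]
  · rw [hratioS, div_pow, div_eq_div_iff (by linarith) (by positivity)]
    rw [show c ^ 2 = 1 - s ^ 2 by linarith]
    ring
  · rintro _ ⟨⟨x, y, rfl⟩, hinj⟩
    have h : trinomialT T x y ∈ univalentTrinomials T := ⟨⟨x, y, rfl⟩, hinj⟩
    refine ⟨fun h' => ?_, fun h' => by rw [h']⟩
    have h1 := heval x y h
    rw [hratioS, hratio x y h, div_eq_div_iff (by linarith) (by linarith)] at h'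
    -- Equality here is signed, which excludes `Q`.
    have hxs : x = s * (1 + y) := by linarith
    obtain rfl := hunique x y h hxs
    rw [hxs, hx]
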